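/- Let $\mu\in\mathbb C\setminus\{0,1\}$. For $\tau\in\mathbb C\setminus\mathbb R$ let $\wp$ be the Weierstrass function of the lattice $\mathbb Z\tau+\mathbb Z$, put $e_1=\wp(\tau/2)$, $e_2=\wp(1/2)$, $e_3=\wp((1+\tau)/2)$ and $\lambda(\tau)=(e_3-e_2)/(e_1-e_2)$, and suppose that $\lambda(\tau)=\mu$. For $q\in\mathbb Q\cup\{\infty\}$ the $q$-differential on the Riemann sphere $\hat{\mathbb C}$ is $$\omega_q=\frac{a}{z(z-1)(z-\mu)}\,dz^2,\qquad a=\frac{k}{(1+q\tau)^2(e_1-e_2)}\ \ (q\in\mathbb Q),\qquad a=\frac{k}{\tau^2(e_1-e_2)}\ \ (q=\infty),$$ where $k>0$ is an arbitrary scaling factor. Its horizontal geodesics are the curves $\gamma$ in $\hat{\mathbb C}\setminus\{0,1,\mu,\infty\}$ with $\frac{a}{\gamma(\gamma-1)(\gamma-\mu)}\,\gamma'^2>0$; its trajectories are the maximal ones, and a trajectory is closed if it is a closed curve. Write $q=m/n$ with coprime integers $m,n$ (with $\infty=1/0$). Then $\omega_q$ has a closed trajectory, and for every closed trajectory $\Gamma$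 of $\omega_q$ the complement $\hat{\mathbb C}\setminus\Gamma$ has exactly two connected components, each of which contains exactly two of the points $0,1,\mu,\infty$. The point lying on the same side of $\Gamma$ as $\infty$ is * $1$, if $m$ is odd and $n$ is even; * $0$, if $m$ is even and $n$ is odd; * $\mu$, if $m$ and $n$ are both odd. Consequently $\mathbb Q\cup\{\infty\}$ is the disjoint union of three non-empty parts, one for each of the three ways $\{\infty,1\}\mid\{0,\mu\}$, $\{\infty,0\}\mid\{1,\mu\}$, $\{\infty,\mu\}\mid\{0,1\}$ of separating the four points into pairs by the closed trajectories of $\omega_q$, and these parts are the three parity classes (odd, even), (even, odd), (odd, odd) of $(m,n)$. -/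

import Mathlib

open scoped OnePoint

noncomputable section

/-! ### Quadratic differentials and their trajectories, on an open subset of the plane -/

/-- `γ`, restricted to the open interval `I`, is a horizontal geodesic of the quadratic
differential `f(z) dz²` on `U ⊆ ℂ`: it stays in `U` and `f(γ(t)) γ'(t)² > 0` for all `t ∈ I`. -/
structure IsHorizontalGeodesic (U : Set ℂ) (f : ℂ → ℂ) (I : Set ℝ) (γ : ℝ → ℂ) : Prop where
  isOpen : IsOpen I
  ordConnected : I.OrdConnected
  nonempty : I.Nonempty
  mapsTo : ∀ t ∈ I, γ t ∈ U
  differentiableAt : ∀ t ∈ I, DifferentiableAt ℝ γ t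
  pos : ∀ t ∈ I, ∃ r : ℝ, 0 < r ∧ f (γ t) * (deriv γ t) ^ 2 = (r : ℂ)

/-- A trajectory of `f(z) dz²` on `U` (as a point set): a horizontal geodesic which is not
contained in a larger horizontal geodesic. -/
def IsTrajectory (U : Set ℂ) (f : ℂ → ℂ) (Γ : Set ℂ) : Prop :=
  (∃ (I : Set ℝ) (γ : ℝ → ℂ), IsHorizontalGeodesic U f I γ ∧ Γ = γ '' I) ∧
    ∀ (J : Set ℝ) (δ : ℝ → ℂ), IsHorizontalGeodesic U f J δ → Γ ⊆ δ '' J → δ '' J = Γ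

/-- A closed trajectory: a trajectory which is traced by a periodic horizontal geodesic. -/
def IsClosedTrajectory (U : Set ℂ) (f : ℂ → ℂ) (Γ : Set ℂ) : Prop :=
  IsTrajectory U f Γ ∧
    ∃ (γ : ℝ → ℂ) (p : ℝ), 0 < p ∧ Function.Periodic γ p ∧
      IsHorizontalGeodesic U f Set.univ γ ∧ Γ = Set.range γ

/-- The complement of `Γ` in the Riemann sphere `OnePoint ℂ` consists of exactly two regions
(connected components); one of them contains `a` and `b`, the other one contains `c` and `d`. -/
def SeparatesPairs (Γ : Set ℂ) (a b c d : OnePoint ℂ) : Prop :=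
  ∃ V W : Set (OnePoint ℂ), IsOpen V ∧ IsOpen W ∧ IsConnected V ∧ IsConnected W ∧
    Disjoint V W ∧ V ∪ W = ((fun z : ℂ => (z : OnePoint ℂ)) '' Γ)ᶜ ∧
    a ∈ V ∧ b ∈ V ∧ c ∈ W ∧ d ∈ W

/-! ### The lattice `ℤ τ + ℤ`, its branch values and the modular lambda function -/

/-- The periods `ω₁ = τ`, `ω₂ = 1`. -/
def latticePair (τ : ℂ) (hτ : τ.im ≠ 0) : PeriodPair where
  ω₁ := τ
  ω₂ := 1
  indep := by
    rw [LinearIndependent.pair_iff]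
    intro s t h
    have h1 := congrArg Complex.im h
    have h2 := congrArg Complex.re h
    simp [hτ] at h1
    subst h1
    simpa using h2

/-- `e₁ = ℘(ω₁ / 2)`. -/
def branchE₁ (L : PeriodPair) : ℂ := L.weierstrassP (L.ω₁ / 2)

/-- `e₂ = ℘(ω₂ / 2)`. -/
def branchE₂ (L : PeriodPair) : ℂ := L.weierstrassP (L.ω₂ / 2)

/-- `e₃ = ℘((ω₁ + ω₂) / 2)`. -/
def branchE₃ (L : PeriodPair) : ℂ := L.weierstrassP ((L.ω₁ + L.ω₂) / 2)

/-- The modular lambda function, `λ(τ) = (e₃ - e₂) / (e₁ - e₂)` for `τ ∈ ℂ \ ℝ`. -/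
def modularLambda (τ : ℂ) (hτ : τ.im ≠ 0) : ℂ :=
  (branchE₃ (latticePair τ hτ) - branchE₂ (latticePair τ hτ)) /
    (branchE₁ (latticePair τ hτ) - branchE₂ (latticePair τ hτ))

/-! ### The differentials on the four-punctured sphere -/

/-- The four-punctured sphere with punctures `0, 1, μ, ∞`, in its coordinate `z`. -/
def puncturedSphere (μ : ℂ) : Set ℂ := {0, 1, μ}ᶜ

/-- The direction `1 + q τ` of the `q`-lines, which is `τ` for `q = ∞`. -/
def qDirection (τ : ℂ) : OnePoint ℚ → ℂ
  | ∞ => τ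
  | (q : ℚ) => 1 + (q : ℂ) * τ

/-- The coefficient of the `q`-differential `a / (z (z - 1) (z - μ)) dz²`, where
`a = k / ((1 + q τ)² (e₁ - e₂))` for `q ∈ ℚ` and `a = k / (τ² (e₁ - e₂))` for `q = ∞`.
The differential is determined up to the scaling factor `k > 0`. -/
def qDifferential (μ τ : ℂ) (hτ : τ.im ≠ 0) (q : OnePoint ℚ) (k : ℝ) (z : ℂ) : ℂ :=
  ((k : ℂ) / ((qDirection τ q) ^ 2 *
      (branchE₁ (latticePair τ hτ) - branchE₂ (latticePair τ hτ)))) /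
    (z * (z - 1) * (z - μ))

/-- `q = m / n` with `m, n` coprime, where `∞ = 1 / 0`. -/
def IsLowestTerms (q : OnePoint ℚ) (m n : ℤ) : Prop :=
  IsCoprime m n ∧ (n = 0 → q = ∞) ∧ (n ≠ 0 → q = (((m : ℚ) / (n : ℚ) : ℚ) : OnePoint ℚ))

/-- The set of those `q` for which the closed trajectories of the `q`-differential separate
`{∞, x}` from `{y, z}`. -/
def separationPart (μ τ : ℂ) (hτ : τ.im ≠ 0) (x y z : ℂ) : Set (OnePoint ℚ) :=
  {q | ∀ k : ℝ, 0 < k → ∀ Γ : Set ℂ,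
    IsClosedTrajectory (puncturedSphere μ) (qDifferential μ τ hτ q k) Γ →
      SeparatesPairs Γ ∞ (x : OnePoint ℂ) (y : OnePoint ℂ) (z : OnePoint ℂ)}

end

noncomputable section

open Filter Topology Set

/-! The map `normP`, extended by ∞ at lattice points, is the quotient of the plane by translations
by lattice vectors and by `u ↦ -u` (`sphereMap_eq_iff`, `surjective_sphereMap`). It sends the
classes of half periods to `1`, `0`, `μ`, and the lattice to `∞`. The equation `℘'² = 4 (℘ - e₁) (℘
- e₂) (℘ - e₃)` makes the `q`-differential pull back to a constant multiple of `du²`, and its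
geodesics lift infinitesimally to motion parallel to the lattice vector `ℓ = m ω₁ + n ω₂`.

Let `f` be the real linear form with values `n`, `-m` at `ω₁`, `ω₂`. It kills `ℓ` and is integral on
the lattice, so `cos (2π f)` descends to a continuous function on the sphere, `levelFun`, which is
constant along every geodesic. Its levels `-1 < c < 1` are images of single lines parallel to `ℓ`,
hence closed; the levels `±1` carry no closed trajectory. So the closed trajectories are exactly the
levels `-1 < c < 1` (`isClosedTrajectory_iff`).

Such a level cuts the sphere into `{> c}` and `{< c}`, each the image of a strip and so connected
(`separatesPairs_levelSet`). The values at `∞, 1, 0, μ` are `1, (-1)^n, (-1)^m, (-1)^(m+n)`, and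
these signs tell which point lies on the side of `∞`. -/

theorem analyticOrderAt_eq_top_of_deriv_deriv_eq_mul {d h : ℂ → ℂ} {z₀ : ℂ}
    (hd : AnalyticAt ℂ d z₀) (hh : AnalyticAt ℂ h z₀) (h0 : d z₀ = 0) (h1 : deriv d z₀ = 0)
    (h2 : deriv (deriv d) =ᶠ[𝓝 z₀] h * d) : analyticOrderAt d z₀ = ⊤ := by
  by_contra htop
  obtain ⟨n, hn⟩ := ENat.ne_top_iff_exists.mp htop
  have hn0 : n ≠ 0 := by
    rintro rfl
    exact (hd.analyticOrderAt_ne_zero.mpr h0) hn.symm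
  obtain ⟨k, rfl⟩ := Nat.exists_eq_succ_of_ne_zero hn0
  have hk : analyticOrderAt (deriv d) z₀ = k :=
    analyticOrderAt_deriv_of_pos hd (by rw [← hn]; push_cast; rfl)
  have hk0 : k ≠ 0 := by
    rintro rfl
    exact (hd.deriv.analyticOrderAt_ne_zero.mpr h1) hk
  obtain ⟨j, rfl⟩ := Nat.exists_eq_succ_of_ne_zero hk0
  have hj : analyticOrderAt (deriv (deriv d)) z₀ = j :=
    analyticOrderAt_deriv_of_pos hd.deriv (by rw [hk]; push_cast; rfl)
  -- Two derivatives lower a finite order by two, while multiplying by `h` cannot lower it.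
  rw [analyticOrderAt_congr h2, analyticOrderAt_mul hh hd, ← hn] at hj
  have : ((j.succ.succ : ℕ) : ℕ∞) ≤ j := hj ▸ le_add_self
  have := ENat.natCast_le_natCast.mp this
  omega

theorem isPreconnected_compl_of_countable {s : Set ℂ} (hs : s.Countable) :
    IsPreconnected sᶜ :=
  (hs.isConnected_compl_of_one_lt_rank (by simp [Complex.rank_real_complex])).isPreconnected

theorem not_tendsto_cobounded_of_tendsto_nhds {l : ℂ} {f : ℂ → ℂ} {a : ℂ}
    (h : Tendsto f (𝓝[≠] l) (𝓝 a)) (h' : Tendsto f (𝓝[≠] l) (Bornology.cobounded ℂ)) : False := by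
  have h1 := tendsto_norm_atTop_iff_cobounded.mpr h'
  exact not_tendsto_nhds_of_tendsto_atTop h1 _ h.norm

/-! ### The differential equations and the fibres of ℘ -/

namespace PeriodPair

variable (L : PeriodPair)

theorem countable_lattice : (L.lattice : Set ℂ).Countable := by
  have : Countable L.lattice := L.latticeEquivProd.toEquiv.countable_iff.mpr inferInstance
  exact Set.to_countable _

theorem tendsto_weierstrassP_cobounded {l : ℂ} (hl : l ∈ L.lattice) :
    Tendsto L.weierstrassP (𝓝[≠] l) (Bornology.cobounded ℂ) :=
  tendsto_cobounded_of_meromorphicOrderAt_neg (by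
    rw [L.order_weierstrassP l hl, show (-2 : WithTop ℤ) = ((-2 : ℤ) : WithTop ℤ) by norm_num]
    exact WithTop.coe_lt_coe.mpr (by norm_num))

theorem eventually_notMem_lattice_nhdsNE (l : ℂ) : ∀ᶠ z in 𝓝[≠] l, z ∉ L.lattice := by
  filter_upwards [self_mem_nhdsWithin,
    mem_nhdsWithin_of_mem_nhds (L.compl_lattice_sdiff_singleton_mem_nhds l)] with z hz hz' hl
  exact hz' ⟨hl, hz⟩

theorem hasDerivAt_weierstrassP {z : ℂ} (hz : z ∉ L.lattice) :
    HasDerivAt L.weierstrassP (L.derivWeierstrassP z) z := by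
  rw [← L.deriv_weierstrassP]
  exact (L.analyticOnNhd_weierstrassP z hz).differentiableAt.hasDerivAt

theorem exists_derivWeierstrassP_ne_zero : ∃ z, z ∉ L.lattice ∧ L.derivWeierstrassP z ≠ 0 := by
  by_contra! h
  have hU := L.isClosed_lattice.isOpen_compl
  obtain ⟨a, ha⟩ := hU.exists_is_const_of_deriv_eq_zero
    (isPreconnected_compl_of_countable L.countable_lattice) L.differentiableOn_weierstrassP
    (fun z hz => by rw [L.deriv_weierstrassP]; exact h z hz)
  refine not_tendsto_cobounded_of_tendsto_nhds (a := a) ?_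
    (L.tendsto_weierstrassP_cobounded L.lattice.zero_mem)
  exact tendsto_const_nhds.congr'
    ((L.eventually_notMem_lattice_nhdsNE 0).mono fun z hz => (ha z hz).symm)

/-- `℘'' = 6 ℘² - g₂ / 2`. -/
theorem hasDerivAt_derivWeierstrassP {z : ℂ} (hz : z ∉ L.lattice) :
    HasDerivAt L.derivWeierstrassP (6 * L.weierstrassP z ^ 2 - L.g₂ / 2) z := by
  have hU := L.isClosed_lattice.isOpen_compl
  have hA := L.analyticOnNhd_derivWeierstrassP
  have hP := L.analyticOnNhd_weierstrassP
  -- Differentiating the cubic equation for `℘'²` gives the claim multiplied by `℘'`; on the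
  -- connected complement of the lattice this nonzero analytic factor cancels.
  have key : ∀ z ∈ (L.lattice : Set ℂ)ᶜ, L.derivWeierstrassP z *
      (deriv L.derivWeierstrassP z - (6 * L.weierstrassP z ^ 2 - L.g₂ / 2)) = 0 := by
    intro z hz
    have h1 := ((hA z hz).differentiableAt.hasDerivAt).pow 2
    have hd := L.hasDerivAt_weierstrassP hz
    have h2 := (((hd.pow 3).const_mul 4).sub (hd.const_mul L.g₂)).sub_const L.g₃
    have h3 := h1.congr_of_eventuallyEq (f₁ := fun z => 4 * L.weierstrassP z ^ 3 -
        L.g₂ * L.weierstrassP z - L.g₃) (by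
      filter_upwards [hU.mem_nhds hz] with w hw
      exact (L.derivWeierstrassP_sq w hw).symm)
    have := h3.unique h2
    push_cast at this
    linear_combination this / 2
  have hB : AnalyticOnNhd ℂ (fun z => deriv L.derivWeierstrassP z -
      (6 * L.weierstrassP z ^ 2 - L.g₂ / 2)) (L.lattice : Set ℂ)ᶜ := by
    intro w hw
    have h1 := (hA w hw).deriv
    have h2 := hP w hw
    fun_prop
  rcases hA.eq_zero_or_eq_zero_of_mul_eq_zero hB key
    (isPreconnected_compl_of_countable L.countable_lattice) with h | h
  · obtain ⟨w, hw, hw'⟩ := L.exists_derivWeierstrassP_ne_zero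
    exact absurd (h w hw) hw'
  · rw [← sub_eq_zero.mp (h z hz)]
    exact (hA z hz).differentiableAt.hasDerivAt

/-- Both ℘ and its translate by `w = v - u` solve `y'' = 6 y² - g₂ / 2` with the same initial data
at `u`, so they agree off their poles. If `w` were not a period, the translate would be regular at
`0`, where ℘ has a pole. -/
theorem sub_mem_lattice_of_weierstrassP_eq {u v : ℂ} (hu : u ∉ L.lattice) (hv : v ∉ L.lattice)
    (h : L.weierstrassP u = L.weierstrassP v)
    (h' : L.derivWeierstrassP u = L.derivWeierstrassP v) : v - u ∈ L.lattice := by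
  by_contra hw
  set w := v - u with hw_def
  have hP := L.analyticOnNhd_weierstrassP
  set s : Set ℂ := (L.lattice : Set ℂ) ∪ (fun z => z + w) ⁻¹' (L.lattice : Set ℂ) with hs
  have hs_count : s.Countable :=
    L.countable_lattice.union (L.countable_lattice.preimage (add_left_injective w))
  have hs_closed : IsClosed s :=
    L.isClosed_lattice.union (L.isClosed_lattice.preimage (by fun_prop))
  have hus : u ∈ sᶜ := by
    rintro (h | h)
    · exact hu h
    · exact hv (by simpa [w] using h)
  have hg : ∀ z ∈ sᶜ, HasDerivAt (fun z => L.weierstrassP (z + w)) (L.derivWeierstrassP (z + w)) z :=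
    fun z hz => (L.hasDerivAt_weierstrassP fun h => hz (Or.inr h)).comp_add_const z w
  have hg' : ∀ z ∈ sᶜ, HasDerivAt (fun z => L.derivWeierstrassP (z + w))
      (6 * L.weierstrassP (z + w) ^ 2 - L.g₂ / 2) z :=
    fun z hz => (L.hasDerivAt_derivWeierstrassP fun h => hz (Or.inr h)).comp_add_const z w
  have hf : ∀ z ∈ sᶜ, HasDerivAt L.weierstrassP (L.derivWeierstrassP z) z :=
    fun z hz => L.hasDerivAt_weierstrassP fun h => hz (Or.inl h)
  have hf' : ∀ z ∈ sᶜ, HasDerivAt L.derivWeierstrassP (6 * L.weierstrassP z ^ 2 - L.g₂ / 2) z :=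
    fun z hz => L.hasDerivAt_derivWeierstrassP fun h => hz (Or.inl h)
  have hopen := hs_closed.isOpen_compl
  have hfa : AnalyticOnNhd ℂ L.weierstrassP sᶜ := hP.mono (compl_subset_compl.mpr subset_union_left)
  have hga : AnalyticOnNhd ℂ (fun z => L.weierstrassP (z + w)) sᶜ :=
    DifferentiableOn.analyticOnNhd
      (fun z hz => (hg z hz).differentiableAt.differentiableWithinAt) hopen
  set d : ℂ → ℂ := fun z => L.weierstrassP z - L.weierstrassP (z + w) with hd_def
  have hda : AnalyticOnNhd ℂ d sᶜ := hfa.sub hga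
  have hd1 : ∀ z ∈ sᶜ, deriv d z = L.derivWeierstrassP z - L.derivWeierstrassP (z + w) :=
    fun z hz => ((hf z hz).sub (hg z hz)).deriv
  have hd2 : ∀ z ∈ sᶜ, deriv (deriv d) z =
      (6 * (L.weierstrassP z + L.weierstrassP (z + w))) * d z := by
    intro z hz
    have : deriv d =ᶠ[𝓝 z] fun z => L.derivWeierstrassP z - L.derivWeierstrassP (z + w) := by
      filter_upwards [hopen.mem_nhds hz] using hd1
    rw [this.deriv_eq, ((hf' z hz).fun_sub (hg' z hz)).deriv]
    simp only [hd_def]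
    ring
  have huw : u + w = v := by simp [w]
  have htop := analyticOrderAt_eq_top_of_deriv_deriv_eq_mul
    (h := fun z => 6 * (L.weierstrassP z + L.weierstrassP (z + w))) (hda u hus)
    (by have h1 := hfa u hus; have h2 := hga u hus; fun_prop)
    (by simp [hd_def, huw, h]) (by rw [hd1 u hus, huw, h', sub_self])
    (by filter_upwards [hopen.mem_nhds hus] using hd2)
  have hzero : EqOn d 0 sᶜ := hda.eqOn_zero_of_preconnected_of_eventuallyEq_zero
    (isPreconnected_compl_of_countable hs_count) hus (analyticOrderAt_eq_top.mp htop)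
  refine not_tendsto_cobounded_of_tendsto_nhds (l := 0) (a := L.weierstrassP w) ?_
    (L.tendsto_weierstrassP_cobounded L.lattice.zero_mem)
  have hc : Tendsto (fun z => L.weierstrassP (z + w)) (𝓝[≠] 0) (𝓝 (L.weierstrassP w)) := by
    have h1 : ContinuousAt (fun z => L.weierstrassP (z + w)) 0 := by
      have : ContinuousAt L.weierstrassP (0 + w) := by
        rw [zero_add]; exact (hP w hw).continuousAt
      exact this.comp (f := fun z => z + w) (by fun_prop)
    simpa [ContinuousAt] using h1.tendsto.mono_left nhdsWithin_le_nhds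
  refine hc.congr' ?_
  have h1 : ∀ᶠ z in 𝓝[≠] (0 : ℂ), z + w ∉ L.lattice := by
    refine nhdsWithin_le_nhds ?_
    have : ContinuousAt (fun z : ℂ => z + w) 0 := by fun_prop
    exact this.eventually_mem (L.isClosed_lattice.isOpen_compl.mem_nhds (by simpa using hw))
  filter_upwards [h1, L.eventually_notMem_lattice_nhdsNE 0] with z hz hz'
  have := hzero (x := z) (by rintro (h | h); exacts [hz' h, hz h])
  exact (sub_eq_zero.mp this).symm

theorem weierstrassP_eq_iff {u v : ℂ} (hu : u ∉ L.lattice) (hv : v ∉ L.lattice) :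
    L.weierstrassP u = L.weierstrassP v ↔ v - u ∈ L.lattice ∨ v + u ∈ L.lattice := by
  constructor
  · intro h
    have hsq : L.derivWeierstrassP u ^ 2 = L.derivWeierstrassP v ^ 2 := by
      rw [L.derivWeierstrassP_sq u hu, L.derivWeierstrassP_sq v hv, h]
    rcases sq_eq_sq_iff_eq_or_eq_neg.mp hsq with h' | h'
    · exact Or.inl (L.sub_mem_lattice_of_weierstrassP_eq hu hv h h')
    · right
      have hu' : -u ∉ L.lattice := fun h => hu (by simpa using L.lattice.neg_mem h)
      have := L.sub_mem_lattice_of_weierstrassP_eq hu' hv (by simpa using h) (by simp [h'])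
      simpa using this
  · rintro (h | h)
    · simpa using (L.weierstrassP_add_coe u ⟨_, h⟩).symm
    · simpa using (L.weierstrassP_add_coe (-u) ⟨_, h⟩).symm

/-! ### Half periods and branch values -/

theorem derivWeierstrassP_eq_zero_of_two_mul_mem {u : ℂ} (hu : 2 * u ∈ L.lattice) :
    L.derivWeierstrassP u = 0 := by
  have h := L.derivWeierstrassP_add_coe (-u) ⟨_, hu⟩
  rw [L.derivWeierstrassP_neg, show -u + 2 * u = u by ring] at h
  linear_combination h / 2

theorem half_add_half_notMem_lattice : (L.ω₁ + L.ω₂) / 2 ∉ L.lattice := by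
  have := (L.mul_ω₁_add_mul_ω₂_mem_lattice (α := 1 / 2) (β := 1 / 2)).not.mpr (by norm_num)
  convert this using 2
  push_cast
  ring

theorem branchE₁_ne_branchE₂ : branchE₁ L ≠ branchE₂ L := by
  intro h
  rcases (L.weierstrassP_eq_iff L.ω₁_div_two_notMem_lattice L.ω₂_div_two_notMem_lattice).mp h
    with h | h
  · refine (L.mul_ω₁_add_mul_ω₂_mem_lattice (α := -1 / 2) (β := 1 / 2)).not.mpr (by norm_num) ?_
    convert h using 1
    push_cast
    ring
  · refine L.half_add_half_notMem_lattice ?_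
    convert h using 1
    ring

theorem branchE₁_ne_branchE₃ : branchE₁ L ≠ branchE₃ L := by
  intro h
  rcases (L.weierstrassP_eq_iff L.ω₁_div_two_notMem_lattice L.half_add_half_notMem_lattice).mp h
    with h | h
  · refine L.ω₂_div_two_notMem_lattice ?_
    convert h using 1
    ring
  · refine L.ω₂_div_two_notMem_lattice ?_
    convert sub_mem h L.ω₁_mem_lattice using 1
    ring

theorem branchE₂_ne_branchE₃ : branchE₂ L ≠ branchE₃ L := by
  intro h
  rcases (L.weierstrassP_eq_iff L.ω₂_div_two_notMem_lattice L.half_add_half_notMem_lattice).mp h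
    with h | h
  · refine L.ω₁_div_two_notMem_lattice ?_
    convert h using 1
    ring
  · refine L.ω₁_div_two_notMem_lattice ?_
    convert sub_mem h L.ω₂_mem_lattice using 1
    ring

/-- `℘'² = 4 (℘ - e₁) (℘ - e₂) (℘ - e₃)`. -/
theorem derivWeierstrassP_sq_eq_mul {z : ℂ} (hz : z ∉ L.lattice) :
    L.derivWeierstrassP z ^ 2 = 4 * (L.weierstrassP z - branchE₁ L) *
      (L.weierstrassP z - branchE₂ L) * (L.weierstrassP z - branchE₃ L) := by
  have h0 := L.derivWeierstrassP_sq z hz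
  have h1 := L.derivWeierstrassP_sq _ L.ω₁_div_two_notMem_lattice
  have h2 := L.derivWeierstrassP_sq _ L.ω₂_div_two_notMem_lattice
  have h3 := L.derivWeierstrassP_sq _ L.half_add_half_notMem_lattice
  have e1 : 2 * (L.ω₁ / 2) = L.ω₁ := by ring
  have e2 : 2 * (L.ω₂ / 2) = L.ω₂ := by ring
  have e3 : 2 * ((L.ω₁ + L.ω₂) / 2) = L.ω₁ + L.ω₂ := by ring
  rw [L.derivWeierstrassP_eq_zero_of_two_mul_mem (by rw [e1]; exact L.ω₁_mem_lattice)] at h1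
  rw [L.derivWeierstrassP_eq_zero_of_two_mul_mem (by rw [e2]; exact L.ω₂_mem_lattice)] at h2
  rw [L.derivWeierstrassP_eq_zero_of_two_mul_mem
    (by rw [e3]; exact add_mem L.ω₁_mem_lattice L.ω₂_mem_lattice)] at h3
  have n12 := sub_ne_zero.mpr L.branchE₁_ne_branchE₂
  have n13 := sub_ne_zero.mpr L.branchE₁_ne_branchE₃
  have n23 := sub_ne_zero.mpr L.branchE₂_ne_branchE₃
  rw [h0]
  change _ = 4 * branchE₁ L ^ 3 - L.g₂ * branchE₁ L - L.g₃ at h1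
  change _ = 4 * branchE₂ L ^ 3 - L.g₂ * branchE₂ L - L.g₃ at h2
  change _ = 4 * branchE₃ L ^ 3 - L.g₂ * branchE₃ L - L.g₃ at h3
  generalize branchE₁ L = a, branchE₂ L = b, branchE₃ L = c, L.g₂ = g, L.g₃ = g',
    L.weierstrassP z = x at *
  -- The branch values are three distinct roots of the cubic; subtracting their equations and
  -- cancelling differences gives Vieta's relations.
  have hab : g = 4 * (a ^ 2 + a * b + b ^ 2) := by
    apply mul_left_cancel₀ n12
    linear_combination h1 - h2
  have hac : g = 4 * (a ^ 2 + a * c + c ^ 2) := by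
    apply mul_left_cancel₀ n13
    linear_combination h1 - h3
  have hs : a + b + c = 0 := by
    apply mul_left_cancel₀ n23
    linear_combination (hac - hab) / 4
  obtain rfl : c = -a - b := by linear_combination hs
  subst hab
  linear_combination -h1

/-! ### The branched double cover of the sphere -/

/-- The normalisation `(℘ - e₂) / (e₁ - e₂)` of the Weierstrass function. -/
def normP (u : ℂ) : ℂ := (L.weierstrassP u - branchE₂ L) / (branchE₁ L - branchE₂ L)

/-- The value of `normP` at the third half period. -/
def lambda : ℂ := (branchE₃ L - branchE₂ L) / (branchE₁ L - branchE₂ L)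

theorem branchE₁_sub_branchE₂_ne_zero : branchE₁ L - branchE₂ L ≠ 0 :=
  sub_ne_zero.mpr L.branchE₁_ne_branchE₂

theorem analyticOnNhd_normP : AnalyticOnNhd ℂ L.normP (L.lattice : Set ℂ)ᶜ := by
  intro u hu
  have := L.analyticOnNhd_weierstrassP u hu
  exact (this.fun_sub analyticAt_const).fun_div analyticAt_const L.branchE₁_sub_branchE₂_ne_zero

theorem hasDerivAt_normP {u : ℂ} (hu : u ∉ L.lattice) :
    HasDerivAt L.normP (L.derivWeierstrassP u / (branchE₁ L - branchE₂ L)) u :=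
  ((L.hasDerivAt_weierstrassP hu).sub_const _).div_const _

theorem deriv_normP_sq {u : ℂ} (hu : u ∉ L.lattice) :
    deriv L.normP u ^ 2 = 4 * (branchE₁ L - branchE₂ L) *
      (L.normP u * (L.normP u - 1) * (L.normP u - L.lambda)) := by
  have h := L.branchE₁_sub_branchE₂_ne_zero
  rw [(L.hasDerivAt_normP hu).deriv, div_pow, L.derivWeierstrassP_sq_eq_mul hu, normP, lambda]
  field_simp
  ring

theorem tendsto_normP_cobounded {l : ℂ} (hl : l ∈ L.lattice) :
    Tendsto L.normP (𝓝[≠] l) (Bornology.cobounded ℂ) := by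
  have h := L.tendsto_weierstrassP_cobounded hl
  have h1 := tendsto_norm_atTop_iff_cobounded.mpr h
  refine tendsto_norm_atTop_iff_cobounded.mp ?_
  have hc : 0 < ‖branchE₁ L - branchE₂ L‖ := norm_pos_iff.mpr L.branchE₁_sub_branchE₂_ne_zero
  refine tendsto_atTop_mono (fun u => ?_)
    ((tendsto_atTop_add_const_right _ (-‖branchE₂ L‖) h1).atTop_div_const hc)
  rw [normP, norm_div]
  gcongr
  have := norm_sub_norm_le (L.weierstrassP u) (branchE₂ L)
  linarith

open Classical in
/-- The branched double cover `u ↦ (℘(u) - e₂) / (e₁ - e₂)` of the Riemann sphere. -/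
def sphereMap (u : ℂ) : OnePoint ℂ := if u ∈ L.lattice then ∞ else (L.normP u : OnePoint ℂ)

theorem sphereMap_of_mem {u : ℂ} (hu : u ∈ L.lattice) : L.sphereMap u = ∞ := if_pos hu

theorem sphereMap_of_notMem {u : ℂ} (hu : u ∉ L.lattice) :
    L.sphereMap u = (L.normP u : OnePoint ℂ) := if_neg hu

theorem sphereMap_eq_coe_iff {u z : ℂ} :
    L.sphereMap u = (z : OnePoint ℂ) ↔ u ∉ L.lattice ∧ L.normP u = z := by
  by_cases hu : u ∈ L.lattice
  · simp [L.sphereMap_of_mem hu, hu]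
  · simp [L.sphereMap_of_notMem hu, hu]

theorem continuous_sphereMap : Continuous L.sphereMap := by
  rw [continuous_iff_continuousAt]
  intro u
  by_cases hu : u ∈ L.lattice
  · rw [continuousAt_iff_punctured_nhds, L.sphereMap_of_mem hu]
    have h := L.tendsto_normP_cobounded hu
    rw [Metric.cobounded_eq_cocompact, ← coclosedCompact_eq_cocompact] at h
    refine (OnePoint.tendsto_coe_infty.comp h).congr' ?_
    filter_upwards [L.eventually_notMem_lattice_nhdsNE u] with z hz
    exact (L.sphereMap_of_notMem hz).symm
  · have h : ContinuousAt (fun z => (L.normP z : OnePoint ℂ)) u :=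
      OnePoint.continuous_coe.continuousAt.comp (L.analyticOnNhd_normP u hu).continuousAt
    refine h.congr ?_
    filter_upwards [L.isClosed_lattice.isOpen_compl.mem_nhds hu] with z hz
    exact (L.sphereMap_of_notMem hz).symm

theorem sphereMap_add_of_mem (u : ℂ) {l : ℂ} (hl : l ∈ L.lattice) :
    L.sphereMap (u + l) = L.sphereMap u := by
  by_cases hu : u ∈ L.lattice
  · rw [L.sphereMap_of_mem hu, L.sphereMap_of_mem (add_mem hu hl)]
  · have : u + l ∉ L.lattice := fun h => hu (by simpa using sub_mem h hl)
    rw [L.sphereMap_of_notMem hu, L.sphereMap_of_notMem this, normP, normP,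
      L.weierstrassP_add_coe u ⟨l, hl⟩]

theorem sphereMap_neg (u : ℂ) : L.sphereMap (-u) = L.sphereMap u := by
  by_cases hu : u ∈ L.lattice
  · rw [L.sphereMap_of_mem hu, L.sphereMap_of_mem (neg_mem hu)]
  · have : -u ∉ L.lattice := fun h => hu (by simpa using neg_mem h)
    rw [L.sphereMap_of_notMem hu, L.sphereMap_of_notMem this, normP, normP, L.weierstrassP_neg]

/-- By periodicity the range is compact, so its finite part is closed; by the open mapping theorem
it is also open, hence all of ℂ. -/
theorem surjective_sphereMap : Function.Surjective L.sphereMap := by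
  have hcomp : IsCompact (range L.sphereMap) :=
    IsZLattice.isCompact_range_of_periodic L.lattice _ L.continuous_sphereMap
      fun z w hw => L.sphereMap_add_of_mem z hw
  have himage : L.normP '' (L.lattice : Set ℂ)ᶜ =
      (fun z : ℂ => (z : OnePoint ℂ)) ⁻¹' range L.sphereMap := by
    ext z
    simp only [mem_image, mem_preimage, mem_range, sphereMap_eq_coe_iff]
    rfl
  have hclosed : IsClosed (L.normP '' (L.lattice : Set ℂ)ᶜ) := by
    rw [himage]
    exact hcomp.isClosed.preimage OnePoint.continuous_coe
  have hopen : IsOpen (L.normP '' (L.lattice : Set ℂ)ᶜ) := by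
    rcases L.analyticOnNhd_normP.is_constant_or_isOpen
      (isPreconnected_compl_of_countable L.countable_lattice) with ⟨w, hw⟩ | h
    · exfalso
      refine not_tendsto_cobounded_of_tendsto_nhds (a := w) ?_
        (L.tendsto_normP_cobounded L.lattice.zero_mem)
      exact tendsto_const_nhds.congr'
        ((L.eventually_notMem_lattice_nhdsNE 0).mono fun z hz => (hw z hz).symm)
    · exact h _ subset_rfl L.isClosed_lattice.isOpen_compl
  have huniv : L.normP '' (L.lattice : Set ℂ)ᶜ = univ :=
    IsClopen.eq_univ ⟨hclosed, hopen⟩ ⟨_, mem_image_of_mem _ L.ω₁_div_two_notMem_lattice⟩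
  intro z
  induction z using OnePoint.rec with
  | infty => exact ⟨0, L.sphereMap_of_mem L.lattice.zero_mem⟩
  | coe z =>
    have : z ∈ L.normP '' (L.lattice : Set ℂ)ᶜ := huniv ▸ mem_univ z
    rwa [himage] at this

theorem sphereMap_eq_iff {u v : ℂ} :
    L.sphereMap u = L.sphereMap v ↔ v - u ∈ L.lattice ∨ v + u ∈ L.lattice := by
  constructor
  · intro h
    by_cases hu : u ∈ L.lattice
    · rw [L.sphereMap_of_mem hu] at h
      by_cases hv : v ∈ L.lattice
      · exact Or.inl (sub_mem hv hu)
      · simp [L.sphereMap_of_notMem hv] at h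
    · rw [L.sphereMap_of_notMem hu, eq_comm, sphereMap_eq_coe_iff] at h
      refine (L.weierstrassP_eq_iff hu h.1).mp ?_
      have := h.2
      rw [normP, normP, div_left_inj' L.branchE₁_sub_branchE₂_ne_zero, sub_left_inj] at this
      exact this.symm
  · rintro (h | h)
    · simpa using (L.sphereMap_add_of_mem u h).symm
    · simpa [L.sphereMap_neg] using (L.sphereMap_add_of_mem (-u) h).symm

theorem sphereMap_half_ω₁ : L.sphereMap (L.ω₁ / 2) = ((1 : ℂ) : OnePoint ℂ) :=
  L.sphereMap_eq_coe_iff.mpr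
    ⟨L.ω₁_div_two_notMem_lattice, div_self L.branchE₁_sub_branchE₂_ne_zero⟩

theorem sphereMap_half_ω₂ : L.sphereMap (L.ω₂ / 2) = ((0 : ℂ) : OnePoint ℂ) :=
  L.sphereMap_eq_coe_iff.mpr ⟨L.ω₂_div_two_notMem_lattice, by
    rw [normP, show L.weierstrassP (L.ω₂ / 2) = branchE₂ L from rfl, sub_self, zero_div]⟩

theorem sphereMap_half_add_half : L.sphereMap ((L.ω₁ + L.ω₂) / 2) = (L.lambda : OnePoint ℂ) :=
  L.sphereMap_eq_coe_iff.mpr ⟨L.half_add_half_notMem_lattice, rfl⟩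

/-! ### Integral linear forms and the functions they induce on the sphere -/

/-- The real linear form on `ℂ` with values `a` at `ω₁` and `b` at `ω₂`. -/
def latticeForm (a b : ℤ) : ℂ →L[ℝ] ℝ :=
  LinearMap.toContinuousLinearMap ((a : ℝ) • L.basis.coord 0 + (b : ℝ) • L.basis.coord 1)

theorem latticeForm_ω₁ (a b : ℤ) : L.latticeForm a b L.ω₁ = a := by
  have h0 : L.basis.repr L.ω₁ = Finsupp.single 0 1 := by
    rw [← L.basis_zero, Module.Basis.repr_self]
  simp [latticeForm, h0]

theorem latticeForm_ω₂ (a b : ℤ) : L.latticeForm a b L.ω₂ = b := by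
  have h0 : L.basis.repr L.ω₂ = Finsupp.single 1 1 := by
    rw [← L.basis_one, Module.Basis.repr_self]
  simp [latticeForm, h0]

theorem latticeForm_apply (a b : ℤ) (s t : ℝ) :
    L.latticeForm a b (s * L.ω₁ + t * L.ω₂) = a * s + b * t := by
  rw [← Complex.real_smul, ← Complex.real_smul, map_add, map_smul, map_smul, latticeForm_ω₁,
    latticeForm_ω₂, smul_eq_mul, smul_eq_mul, mul_comm s, mul_comm t]

theorem exists_eq_add (u : ℂ) : ∃ s t : ℝ, u = s * L.ω₁ + t * L.ω₂ := by
  refine ⟨L.basis.repr u 0, L.basis.repr u 1, ?_⟩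
  simpa [Fin.sum_univ_two] using (L.basis.sum_repr u).symm

theorem exists_int_latticeForm_eq (a b : ℤ) {l : ℂ} (hl : l ∈ L.lattice) :
    ∃ k : ℤ, L.latticeForm a b l = k := by
  obtain ⟨m, n, rfl⟩ := mem_lattice.mp hl
  refine ⟨a * m + b * n, ?_⟩
  have := L.latticeForm_apply a b m n
  push_cast at this ⊢
  exact this

/-- The function on the sphere which pulls back to `u ↦ cos (2 π f(u))`,
`f` being the linear form `latticeForm a b`. -/
def levelFun (a b : ℤ) (z : OnePoint ℂ) : ℝ :=
  Real.cos (2 * Real.pi * L.latticeForm a b (Function.surjInv L.surjective_sphereMap z))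

/-- The chosen preimage is `±u` up to a period; cosine is even, and the form is integral on periods.
-/
theorem levelFun_sphereMap (a b : ℤ) (u : ℂ) :
    L.levelFun a b (L.sphereMap u) = Real.cos (2 * Real.pi * L.latticeForm a b u) := by
  set v := Function.surjInv L.surjective_sphereMap (L.sphereMap u) with hv
  have h : L.sphereMap v = L.sphereMap u := Function.surjInv_eq L.surjective_sphereMap _
  change Real.cos (2 * Real.pi * L.latticeForm a b v) = _
  rcases L.sphereMap_eq_iff.mp h with h | h <;>
    obtain ⟨k, hk⟩ := L.exists_int_latticeForm_eq a b h
  · rw [map_sub] at hk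
    rw [← Real.cos_add_int_mul_two_pi _ k, ← hk]
    congr 1
    ring
  · rw [map_add] at hk
    rw [← Real.cos_neg, ← Real.cos_add_int_mul_two_pi _ k, ← hk]
    congr 1
    ring

theorem levelFun_normP (a b : ℤ) {u : ℂ} (hu : u ∉ L.lattice) :
    L.levelFun a b (L.normP u) = Real.cos (2 * Real.pi * L.latticeForm a b u) := by
  rw [← L.sphereMap_of_notMem hu, levelFun_sphereMap]

/-- The closed period parallelogram is compact and covers the Hausdorff sphere, so it has the sphere
as a quotient, and continuity can be checked upstairs despite the choice of preimages. -/
theorem continuous_levelFun (a b : ℤ) : Continuous (L.levelFun a b) := by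
  let π : unitInterval × unitInterval → OnePoint ℂ :=
    fun x => L.sphereMap ((x.1 : ℝ) * L.ω₁ + (x.2 : ℝ) * L.ω₂)
  have hπ : Continuous π := L.continuous_sphereMap.comp (by fun_prop)
  have hs : Function.Surjective π := by
    intro z
    obtain ⟨u, rfl⟩ := L.surjective_sphereMap z
    obtain ⟨s, t, rfl⟩ := L.exists_eq_add u
    refine ⟨⟨⟨Int.fract s, Int.fract_nonneg s, (Int.fract_lt_one s).le⟩,
      ⟨Int.fract t, Int.fract_nonneg t, (Int.fract_lt_one t).le⟩⟩, ?_⟩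
    refine Eq.trans ?_ (L.sphereMap_add_of_mem _ (mem_lattice.mpr ⟨-⌊s⌋, -⌊t⌋, rfl⟩))
    change L.sphereMap _ = _
    congr 1
    simp only [Int.fract]
    push_cast
    ring
  have hq : IsQuotientMap π := hπ.isClosedMap.isQuotientMap hπ hs
  rw [hq.continuous_iff]
  have : L.levelFun a b ∘ π = fun x => Real.cos (2 * Real.pi *
      L.latticeForm a b ((x.1 : ℝ) * L.ω₁ + (x.2 : ℝ) * L.ω₂)) :=
    funext fun x => L.levelFun_sphereMap a b _
  rw [this]
  fun_prop

theorem levelFun_infty (a b : ℤ) : L.levelFun a b ∞ = 1 := by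
  rw [← L.sphereMap_of_mem L.lattice.zero_mem, levelFun_sphereMap]
  simp

/-- At a half period the form is half an integer, so the cosine is the sign of a parity. The values
at `0` and `lambda` arise in the same way. -/
theorem levelFun_one (a b : ℤ) : L.levelFun a b ((1 : ℂ) : OnePoint ℂ) = (-1) ^ a := by
  have h := L.latticeForm_apply a b (1 / 2) 0
  rw [← L.sphereMap_half_ω₁, levelFun_sphereMap,
    show L.ω₁ / 2 = ((1 / 2 : ℝ) : ℂ) * L.ω₁ + ((0 : ℝ) : ℂ) * L.ω₂ by push_cast; ring, h,
    ← Real.cos_int_mul_pi]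
  congr 1
  ring

theorem levelFun_zero (a b : ℤ) : L.levelFun a b ((0 : ℂ) : OnePoint ℂ) = (-1) ^ b := by
  have h := L.latticeForm_apply a b 0 (1 / 2)
  rw [← L.sphereMap_half_ω₂, levelFun_sphereMap,
    show L.ω₂ / 2 = ((0 : ℝ) : ℂ) * L.ω₁ + ((1 / 2 : ℝ) : ℂ) * L.ω₂ by push_cast; ring, h,
    ← Real.cos_int_mul_pi]
  congr 1
  ring

theorem levelFun_lambda (a b : ℤ) : L.levelFun a b (L.lambda : OnePoint ℂ) = (-1) ^ (a + b) := by
  have h := L.latticeForm_apply a b (1 / 2) (1 / 2)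
  rw [← L.sphereMap_half_add_half, levelFun_sphereMap,
    show (L.ω₁ + L.ω₂) / 2 = ((1 / 2 : ℝ) : ℂ) * L.ω₁ + ((1 / 2 : ℝ) : ℂ) * L.ω₂ by
      push_cast; ring, h, ← Real.cos_int_mul_pi]
  congr 1
  push_cast
  ring

theorem abs_levelFun_le_one (a b : ℤ) (z : OnePoint ℂ) : |L.levelFun a b z| ≤ 1 :=
  Real.abs_cos_le_one _

/-- A local inverse of `normP` lifts `γ` near `t` to a curve through `u` with velocity `w`; no
global lift is needed. -/
theorem hasDerivAt_levelFun_comp (a b : ℤ) {γ : ℝ → ℂ} {t : ℝ} {u w : ℂ} (hu : u ∉ L.lattice)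
    (hγt : γ t = L.normP u) (hne : deriv L.normP u ≠ 0)
    (hγ : HasDerivAt γ (deriv L.normP u * w) t) :
    HasDerivAt (fun s => L.levelFun a b (γ s))
      (-Real.sin (2 * Real.pi * L.latticeForm a b u) * (2 * Real.pi * L.latticeForm a b w)) t := by
  have hF : HasStrictDerivAt L.normP (deriv L.normP u) u :=
    (L.analyticOnNhd_normP u hu).hasStrictDerivAt
  set g := hF.localInverse L.normP _ u hne
  have hgu : g (L.normP u) = u := (hF.eventually_left_inverse hne).self_of_nhds
  have hg : HasDerivAt g (deriv L.normP u)⁻¹ (γ t) := by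
    rw [hγt]
    exact (hF.to_localInverse hne).hasDerivAt
  have hgγ : HasDerivAt (fun s => g (γ s)) w t := by
    have := hg.comp t hγ
    rwa [inv_mul_cancel_left₀ hne] at this
  have hlev : HasDerivAt (fun s => Real.cos (2 * Real.pi * L.latticeForm a b (g (γ s))))
      (-Real.sin (2 * Real.pi * L.latticeForm a b u) *
        (2 * Real.pi * L.latticeForm a b w)) t := by
    have h1 := (((L.latticeForm a b).hasFDerivAt.comp_hasDerivAt t hgγ).const_mul
      (2 * Real.pi)).cos
    simpa [hγt, hgu] using h1
  refine hlev.congr_of_eventuallyEq ?_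
  have h1 : ∀ᶠ s in 𝓝 t, L.normP (g (γ s)) = γ s := by
    have := hF.eventually_right_inverse hne
    rw [← hγt] at this
    exact hγ.continuousAt.eventually this
  have h2 : ∀ᶠ s in 𝓝 t, g (γ s) ∉ L.lattice :=
    hgγ.continuousAt.eventually_mem
      (L.isClosed_lattice.isOpen_compl.mem_nhds (by simpa [hγt, hgu] using hu))
  filter_upwards [h1, h2] with s hs hs'
  rw [← L.levelFun_normP a b hs', hs]

/-! ### Lattice coordinates adapted to the direction `ℓ` -/

section Unimodular

variable {m n p r : ℤ} (h : p * m + r * n = 1)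
include h

/-- By Bézout, `ℓ = m ω₁ + n ω₂` and `ℓ' = r ω₁ - p ω₂` form a lattice basis, whose dual basis is
the pair of forms used here. -/
theorem eq_latticeForm_mul_add (u : ℂ) :
    u = L.latticeForm p r u * (m * L.ω₁ + n * L.ω₂) +
      L.latticeForm n (-m) u * (r * L.ω₁ - p * L.ω₂) := by
  obtain ⟨s, t, rfl⟩ := L.exists_eq_add u
  have hC : (p * m + r * n : ℂ) = 1 := by exact_mod_cast h
  rw [latticeForm_apply, latticeForm_apply]
  push_cast
  linear_combination (-s * L.ω₁ - t * L.ω₂) * hC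

theorem latticeForm_add_transversal (u : ℂ) (x : ℝ) :
    L.latticeForm n (-m) (u + x * (r * L.ω₁ - p * L.ω₂)) = L.latticeForm n (-m) u + x := by
  have h1 := L.latticeForm_apply n (-m) (x * r) (-x * p)
  have hR : (p * m + r * n : ℝ) = 1 := by exact_mod_cast h
  rw [map_add, show (x * (r * L.ω₁ - p * L.ω₂) : ℂ) =
    ((x * r : ℝ) : ℂ) * L.ω₁ + ((-x * p : ℝ) : ℂ) * L.ω₂ by push_cast; ring, h1]
  push_cast
  linear_combination x * hR

/-- Translation by a multiple of `ℓ'` brings the height into `[-1/2, 1/2]`, and the symmetry `u ↦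
-u` folds this onto `[0, 1/2]`. -/
theorem exists_sphereMap_eq_latticeForm_mem (z : OnePoint ℂ) :
    ∃ u, L.sphereMap u = z ∧ 0 ≤ L.latticeForm n (-m) u ∧ L.latticeForm n (-m) u ≤ 1 / 2 := by
  obtain ⟨u, rfl⟩ := L.surjective_sphereMap z
  have hmem : ((-round (L.latticeForm n (-m) u) : ℝ) : ℂ) * (r * L.ω₁ - p * L.ω₂) ∈ L.lattice := by
    refine mem_lattice.mpr ⟨-round (L.latticeForm n (-m) u) * r,
      round (L.latticeForm n (-m) u) * p, ?_⟩
    push_cast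
    ring
  have habs := abs_le.mp (abs_sub_round (L.latticeForm n (-m) u))
  have hv := L.latticeForm_add_transversal h u (-round (L.latticeForm n (-m) u))
  have hv' := L.sphereMap_add_of_mem u hmem
  set v := u + ((-round (L.latticeForm n (-m) u) : ℝ) : ℂ) * (r * L.ω₁ - p * L.ω₂)
  rcases le_total 0 (L.latticeForm n (-m) v) with h0 | h0
  · exact ⟨v, hv', h0, by rw [hv]; linarith [habs.2]⟩
  · refine ⟨-v, by rw [sphereMap_neg, hv'], ?_, ?_⟩ <;> rw [map_neg]
    · linarith
    · rw [hv]; linarith [habs.1]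

end Unimodular

/-! ### Level sets separate the sphere -/

section LevelSets

variable {m n p r : ℤ} (h : p * m + r * n = 1)
include h

theorem preimage_levelFun_eq_image {S T : Set ℝ} (hT : T ⊆ Icc 0 (1 / 2))
    (hST : ∀ y ∈ Icc (0 : ℝ) (1 / 2), Real.cos (2 * Real.pi * y) ∈ S ↔ y ∈ T) :
    L.levelFun n (-m) ⁻¹' S = L.sphereMap '' (L.latticeForm n (-m) ⁻¹' T) := by
  ext z
  constructor
  · intro hz
    obtain ⟨u, rfl, hu⟩ := L.exists_sphereMap_eq_latticeForm_mem h z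
    rw [mem_preimage, levelFun_sphereMap] at hz
    exact ⟨u, (hST _ hu).mp hz, rfl⟩
  · rintro ⟨u, hu, rfl⟩
    rw [mem_preimage, levelFun_sphereMap]
    exact (hST _ (hT hu)).mpr hu

theorem isConnected_sphereMap_image_preimage {T : Set ℝ} (hT : Convex ℝ T) (hne : T.Nonempty) :
    IsConnected (L.sphereMap '' (L.latticeForm n (-m) ⁻¹' T)) := by
  refine ⟨?_, ?_⟩
  · obtain ⟨x, hx⟩ := hne
    refine Set.Nonempty.image _ ⟨0 + x * (r * L.ω₁ - p * L.ω₂), ?_⟩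
    rw [mem_preimage, L.latticeForm_add_transversal h, map_zero, zero_add]
    exact hx
  · have : Convex ℝ (L.latticeForm n (-m) ⁻¹' T) :=
      hT.linear_preimage (L.latticeForm n (-m)).toLinearMap
    exact this.isPreconnected.image _ L.continuous_sphereMap.continuousOn

omit L h in
theorem exists_cos_two_pi_mul_eq {c : ℝ} (h1 : -1 < c) (h2 : c < 1) :
    ∃ s ∈ Ioo (0 : ℝ) (1 / 2), Real.cos (2 * Real.pi * s) = c := by
  have hπ := Real.pi_pos
  refine ⟨Real.arccos c / (2 * Real.pi), ⟨?_, ?_⟩, ?_⟩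
  · exact div_pos (Real.arccos_pos.mpr h2) (by positivity)
  · rw [div_lt_iff₀ (by positivity)]
    have := Real.arccos_lt_pi.mpr h1
    linarith
  · rw [mul_div_cancel₀ _ (by positivity), Real.cos_arccos h1.le h2.le]

omit L h in
theorem cos_two_pi_mul_lt_iff {x y : ℝ} (hx : x ∈ Icc (0 : ℝ) (1 / 2))
    (hy : y ∈ Icc (0 : ℝ) (1 / 2)) :
    Real.cos (2 * Real.pi * x) < Real.cos (2 * Real.pi * y) ↔ y < x := by
  have hπ := Real.pi_pos
  have key : ∀ z ∈ Icc (0 : ℝ) (1 / 2), 2 * Real.pi * z ∈ Icc 0 Real.pi := fun z hz =>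
    ⟨by have := hz.1; positivity, by nlinarith [hz.2]⟩
  rw [Real.strictAntiOn_cos.lt_iff_gt (key x hx) (key y hy)]
  exact mul_lt_mul_iff_right₀ (by positivity)

/-- A level set of `levelFun` for a value strictly between `-1` and `1` separates the sphere into
two regions. -/
theorem separatesPairs_levelSet {c : ℝ} (h1 : -1 < c) (h2 : c < 1) {a b a' b' : OnePoint ℂ}
    (ha : c < L.levelFun n (-m) a) (hb : c < L.levelFun n (-m) b)
    (ha' : L.levelFun n (-m) a' < c) (hb' : L.levelFun n (-m) b' < c) :
    SeparatesPairs {z : ℂ | L.levelFun n (-m) z = c} a b a' b' := by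
  obtain ⟨s, ⟨hs0, hs1⟩, rfl⟩ := exists_cos_two_pi_mul_eq h1 h2
  have hcont := L.continuous_levelFun n (-m)
  have hs : s ∈ Icc (0 : ℝ) (1 / 2) := ⟨hs0.le, hs1.le⟩
  refine ⟨L.levelFun n (-m) ⁻¹' Ioi (Real.cos (2 * Real.pi * s)),
    L.levelFun n (-m) ⁻¹' Iio (Real.cos (2 * Real.pi * s)), isOpen_Ioi.preimage hcont,
    isOpen_Iio.preimage hcont, ?_, ?_, ?_, ?_, ha, hb, ha', hb'⟩
  -- The cosine decreases in the height on `[0, 1/2]`: values above `c` come from heights in `[0,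
  -- s)`, values below from `(s, 1/2]`.
  · rw [L.preimage_levelFun_eq_image h (T := Ico 0 s) (fun y hy => ⟨hy.1, hy.2.le.trans hs.2⟩)
      fun y hy => by rw [mem_Ioi, cos_two_pi_mul_lt_iff hs hy, mem_Ico, and_iff_right hy.1]]
    exact L.isConnected_sphereMap_image_preimage h (convex_Ico 0 s) ⟨0, le_rfl, hs0⟩
  · rw [L.preimage_levelFun_eq_image h (T := Ioc s (1 / 2)) (fun y hy => ⟨hs.1.trans hy.1.le, hy.2⟩)
      fun y hy => by rw [mem_Iio, cos_two_pi_mul_lt_iff hy hs, mem_Ioc, and_iff_left hy.2]]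
    exact L.isConnected_sphereMap_image_preimage h (convex_Ioc s (1 / 2)) ⟨1 / 2, hs1, le_rfl⟩
  · exact Disjoint.preimage _ (disjoint_left.mpr fun x (hx : _ < x) (hx' : x < _) => lt_asymm hx hx')
  · ext z
    induction z using OnePoint.rec with
    | infty => simp [levelFun_infty, h2]
    | coe z => simp [or_comm]

end LevelSets

/-! ### Pulling the differential back to the plane -/

/-- The quadratic differential on the sphere which pulls back to `(4 k / D²) du²`. -/
def lineDifferential (D : ℂ) (k : ℝ) (z : ℂ) : ℂ :=
  ((k : ℂ) / (D ^ 2 * (branchE₁ L - branchE₂ L))) / (z * (z - 1) * (z - L.lambda))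

theorem mul_ne_zero_of_mem_puncturedSphere {μ z : ℂ} (hz : z ∈ puncturedSphere μ) :
    z * (z - 1) * (z - μ) ≠ 0 := by
  simp only [puncturedSphere, mem_compl_iff, mem_insert_iff, mem_singleton_iff, not_or] at hz
  exact mul_ne_zero (mul_ne_zero hz.1 (sub_ne_zero.mpr hz.2.1)) (sub_ne_zero.mpr hz.2.2)

theorem lineDifferential_normP_mul_sq {D : ℂ} (hD : D ≠ 0) (k : ℝ) {u : ℂ} (hu : u ∉ L.lattice)
    (hz : L.normP u ∈ puncturedSphere L.lambda) (w : ℂ) :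
    L.lineDifferential D k (L.normP u) * (deriv L.normP u * w) ^ 2 = 4 * k * (w / D) ^ 2 := by
  have hQ := mul_ne_zero_of_mem_puncturedSphere hz
  have hE := L.branchE₁_sub_branchE₂_ne_zero
  rw [mul_pow, L.deriv_normP_sq hu, lineDifferential]
  generalize L.normP u * (L.normP u - 1) * (L.normP u - L.lambda) = Q at *
  field_simp

theorem deriv_normP_ne_zero {u : ℂ} (hu : u ∉ L.lattice)
    (hz : L.normP u ∈ puncturedSphere L.lambda) : deriv L.normP u ≠ 0 := by
  intro h0
  have := L.deriv_normP_sq hu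
  rw [h0, zero_pow two_ne_zero, eq_comm] at this
  exact mul_ne_zero (mul_ne_zero (by norm_num) L.branchE₁_sub_branchE₂_ne_zero)
    (mul_ne_zero_of_mem_puncturedSphere hz) this

/-- A horizontal geodesic lifts infinitesimally to a motion in the direction `D`. -/
theorem exists_hasDerivAt_of_isHorizontalGeodesic {D : ℂ} (hD : D ≠ 0) {k : ℝ} (hk : 0 < k)
    {I : Set ℝ} {γ : ℝ → ℂ}
    (hγ : IsHorizontalGeodesic (puncturedSphere L.lambda) (L.lineDifferential D k) I γ)
    {t : ℝ} (ht : t ∈ I) :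
    ∃ (u : ℂ) (x : ℝ), u ∉ L.lattice ∧ γ t = L.normP u ∧ deriv L.normP u ≠ 0 ∧ x ≠ 0 ∧
      HasDerivAt γ (deriv L.normP u * (x * D)) t := by
  obtain ⟨u, hu⟩ := L.surjective_sphereMap (γ t)
  obtain ⟨hu, hut⟩ := L.sphereMap_eq_coe_iff.mp hu
  have hz : L.normP u ∈ puncturedSphere L.lambda := hut ▸ hγ.mapsTo t ht
  have hne := L.deriv_normP_ne_zero hu hz
  obtain ⟨R, hR, hpos⟩ := hγ.pos t ht
  have hd := (hγ.differentiableAt t ht).hasDerivAt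
  obtain ⟨w, hw⟩ : ∃ w, deriv γ t = deriv L.normP u * (w * D) :=
    ⟨(deriv L.normP u)⁻¹ * deriv γ t * D⁻¹, by field_simp⟩
  rw [← hut, hw, L.lineDifferential_normP_mul_sq hD k hu hz, mul_div_cancel_right₀ _ hD] at hpos
  have hkC : (k : ℂ) ≠ 0 := by exact_mod_cast hk.ne'
  -- The geodesic condition now reads `4 k w² = R` with `R > 0`, so `w` is one of two real square
  -- roots.
  have hx : 0 < Real.sqrt (R / (4 * k)) := Real.sqrt_pos.mpr (by positivity)
  have hsq : w ^ 2 = ((Real.sqrt (R / (4 * k)) : ℝ) : ℂ) ^ 2 := by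
    rw [← Complex.ofReal_pow, Real.sq_sqrt (by positivity)]
    push_cast
    rw [← hpos]
    field_simp
  rw [hw] at hd
  rcases sq_eq_sq_iff_eq_or_eq_neg.mp hsq with rfl | rfl
  · exact ⟨u, _, hu, hut.symm, hne, hx.ne', hd⟩
  · exact ⟨u, -Real.sqrt (R / (4 * k)), hu, hut.symm, hne, neg_ne_zero.mpr hx.ne', by
      push_cast; exact hd⟩

/-! ### Closed trajectories are the noncritical levels -/

section Trajectories

variable {m n p r : ℤ}

theorem latticeForm_int_mul_add (a b : ℤ) : L.latticeForm a b (m * L.ω₁ + n * L.ω₂) = a * m + b * n := by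
  have := L.latticeForm_apply a b m n
  push_cast at this
  exact this

/-- Horizontal geodesics stay in the level sets of `levelFun`. -/
theorem exists_image_subset_levelSet {ρ : ℝ} {D : ℂ} (hD : D ≠ 0)
    (hDρ : D = ρ * (m * L.ω₁ + n * L.ω₂)) {k : ℝ} (hk : 0 < k) {I : Set ℝ} {γ : ℝ → ℂ}
    (hγ : IsHorizontalGeodesic (puncturedSphere L.lambda) (L.lineDifferential D k) I γ) :
    ∃ c : ℝ, γ '' I ⊆ {z : ℂ | L.levelFun n (-m) z = c} := by
  have hderiv : ∀ t ∈ I, HasDerivAt (fun s => L.levelFun n (-m) (γ s)) 0 t := by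
    intro t ht
    obtain ⟨u, x, hu, hut, hne, -, hd⟩ := L.exists_hasDerivAt_of_isHorizontalGeodesic hD hk hγ ht
    have h1 := L.hasDerivAt_levelFun_comp n (-m) hu hut hne hd
    have h2 : L.latticeForm n (-m) (x * D) = 0 := by
      rw [hDρ, ← Complex.real_smul, ← Complex.real_smul, map_smul, map_smul, latticeForm_int_mul_add]
      push_cast
      simp only [smul_eq_mul]
      ring
    rwa [h2, mul_zero, mul_zero] at h1
  obtain ⟨c, hc⟩ := hγ.isOpen.exists_is_const_of_deriv_eq_zero hγ.ordConnected.isPreconnected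
    (fun t ht => (hderiv t ht).differentiableAt.differentiableWithinAt)
    (fun t ht => (hderiv t ht).deriv)
  exact ⟨c, image_subset_iff.mpr hc⟩

variable (h : p * m + r * n = 1)
include h

/-- The geodesic is the image of the line `t ℓ + s ℓ'`, where `cos (2π s) = c`; advancing `t` by `1`
adds a period. Every point of the level has a preimage of height `s`, which lies on this line. -/
theorem exists_periodic_geodesic_range_eq_levelSet {ρ : ℝ} {D : ℂ} (hD : D ≠ 0)
    (hDρ : D = ρ * (m * L.ω₁ + n * L.ω₂)) {k : ℝ} (hk : 0 < k) {c : ℝ} (h1 : -1 < c)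
    (h2 : c < 1) :
    ∃ γ : ℝ → ℂ, Function.Periodic γ 1 ∧
      IsHorizontalGeodesic (puncturedSphere L.lambda) (L.lineDifferential D k) univ γ ∧
      range γ = {z : ℂ | L.levelFun n (-m) z = c} := by
  obtain ⟨s, ⟨hs0, hs1⟩, hsc⟩ := exists_cos_two_pi_mul_eq h1 h2
  set ℓ : ℂ := m * L.ω₁ + n * L.ω₂ with hℓ
  set ℓ' : ℂ := r * L.ω₁ - p * L.ω₂ with hℓ'
  have hℓmem : ℓ ∈ L.lattice := mem_lattice.mpr ⟨m, n, rfl⟩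
  set v : ℝ → ℂ := fun t => t * ℓ + s * ℓ' with hv
  have hvs : ∀ t, L.latticeForm n (-m) (v t) = s := by
    intro t
    rw [hv, L.latticeForm_add_transversal h, ← Complex.real_smul, map_smul, hℓ, latticeForm_int_mul_add]
    push_cast
    simp only [smul_eq_mul]
    ring
  have hlev : ∀ t, L.levelFun n (-m) (L.sphereMap (v t)) = c := by
    intro t
    rw [levelFun_sphereMap, hvs, hsc]
  have hnot : ∀ t, v t ∉ L.lattice := by
    intro t ht
    have := hlev t
    rw [L.sphereMap_of_mem ht, levelFun_infty] at this
    exact h2.ne' this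
  have hlev' : ∀ t, L.levelFun n (-m) (L.normP (v t)) = c := by
    intro t
    rw [← L.sphereMap_of_notMem (hnot t), hlev]
  -- All branch points have level `±1`, so the line misses them.
  have hpow : ∀ j : ℤ, ((-1 : ℝ) ^ j) ≠ c := by
    intro j hj
    rcases Int.even_or_odd j with hj' | hj'
    · rw [hj'.neg_one_zpow] at hj; exact h2.ne' hj
    · rw [hj'.neg_one_zpow] at hj; exact h1.ne hj
  have hpunct : ∀ t, L.normP (v t) ∈ puncturedSphere L.lambda := by
    intro t ht
    have := hlev' t
    rcases ht with ht | ht | ht <;> rw [ht] at this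
    · exact hpow _ (L.levelFun_zero _ _ ▸ this)
    · exact hpow _ (L.levelFun_one _ _ ▸ this)
    · exact hpow _ (L.levelFun_lambda _ _ ▸ this)
  have hvd : ∀ t, HasDerivAt v ℓ t := by
    intro t
    simpa [hv] using ((Complex.ofRealCLM.hasDerivAt (x := t)).mul_const ℓ).add_const (s * ℓ')
  have hγd : ∀ t, HasDerivAt (fun t => L.normP (v t)) (deriv L.normP (v t) * ℓ) t := fun t =>
    (L.analyticOnNhd_normP _ (hnot t)).differentiableAt.hasDerivAt.comp t (hvd t)
  refine ⟨fun t => L.normP (v t), ?_, ⟨isOpen_univ, ordConnected_univ, univ_nonempty,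
    fun t _ => hpunct t, fun t _ => (hγd t).differentiableAt, fun t _ => ?_⟩, ?_⟩
  · intro t
    have e : v (t + 1) = v t + ℓ := by
      simp only [hv]
      push_cast
      ring
    have := L.sphereMap_add_of_mem (v t) hℓmem
    rw [← e, L.sphereMap_of_notMem (hnot _), L.sphereMap_of_notMem (hnot _),
      OnePoint.coe_eq_coe] at this
    exact this
  · have hρ : ρ ≠ 0 := by
      rintro rfl
      exact hD (by simp [hDρ])
    have hℓ0 : ℓ ≠ 0 := by
      intro h0
      exact hD (by rw [hDρ, h0, mul_zero])
    -- The lifted velocity is `ℓ = D / ρ`.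
    refine ⟨4 * k * (1 / ρ) ^ 2, by positivity, ?_⟩
    rw [(hγd t).deriv, L.lineDifferential_normP_mul_sq hD k (hnot t) (hpunct t), hDρ]
    have hρC : (ρ : ℂ) ≠ 0 := by exact_mod_cast hρ
    push_cast
    field_simp
  · refine Subset.antisymm (range_subset_iff.mpr hlev') fun z hz => ?_
    obtain ⟨u, hu, hu0, hu1⟩ := L.exists_sphereMap_eq_latticeForm_mem h z
    have hcos : Real.cos (2 * Real.pi * L.latticeForm n (-m) u) = Real.cos (2 * Real.pi * s) := by
      rw [← levelFun_sphereMap, hu, hsc]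
      exact hz
    have hus : L.latticeForm n (-m) u = s := by
      have hs : s ∈ Icc (0 : ℝ) (1 / 2) := ⟨hs0.le, hs1.le⟩
      refine le_antisymm ?_ ?_
      · exact not_lt.mp fun hlt => ((cos_two_pi_mul_lt_iff ⟨hu0, hu1⟩ hs).mpr hlt).ne hcos
      · exact not_lt.mp fun hlt => ((cos_two_pi_mul_lt_iff hs ⟨hu0, hu1⟩).mpr hlt).ne' hcos
    have huv : u = v (L.latticeForm p r u) := by
      have := L.eq_latticeForm_mul_add h u
      rwa [hus] at this
    refine ⟨L.latticeForm p r u, ?_⟩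
    rw [huv] at hu
    exact (L.sphereMap_eq_coe_iff.mp hu).2

/-- A periodic horizontal geodesic does not lie in a critical level set. -/
theorem sq_ne_one_of_periodic_geodesic {ρ : ℝ} {D : ℂ} (hD : D ≠ 0)
    (hDρ : D = ρ * (m * L.ω₁ + n * L.ω₂)) {k : ℝ} (hk : 0 < k) {c : ℝ} {γ : ℝ → ℂ} {T : ℝ}
    (hT : 0 < T) (hper : Function.Periodic γ T)
    (hγ : IsHorizontalGeodesic (puncturedSphere L.lambda) (L.lineDifferential D k) univ γ)
    (hc : ∀ t, L.levelFun n (-m) (γ t) = c) : c ^ 2 ≠ 1 := by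
  intro hc1
  have hρ : ρ ≠ 0 := by
    rintro rfl
    exact hD (by simp [hDρ])
  -- The dual form, with values `p`, `r`, measures motion along `ℓ`; its induced function will have
  -- no critical point along `γ`, against Rolle's theorem on one period.
  have key : ∀ t, ∃ y, y ≠ 0 ∧ HasDerivAt (fun s => L.levelFun p r (γ s)) y t := by
    intro t
    obtain ⟨u, x, hu, hut, hne, hx, hd⟩ :=
      L.exists_hasDerivAt_of_isHorizontalGeodesic hD hk hγ (mem_univ t)
    refine ⟨_, ?_, L.hasDerivAt_levelFun_comp p r hu hut hne hd⟩
    have h2 : L.latticeForm p r (x * D) = x * ρ := by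
      have hR : (p * m + r * n : ℝ) = 1 := by exact_mod_cast h
      rw [hDρ, ← Complex.real_smul, ← Complex.real_smul, map_smul, map_smul, latticeForm_int_mul_add, hR]
      simp
    rw [h2]
    refine mul_ne_zero (neg_ne_zero.mpr fun hsin => ?_)
      (mul_ne_zero (mul_ne_zero two_ne_zero Real.pi_ne_zero) (mul_ne_zero hx hρ))
    have hcos := hc t
    rw [hut, L.levelFun_normP _ _ hu] at hcos
    have hsin' : Real.sin (2 * Real.pi * L.latticeForm n (-m) u) = 0 := by
      have := Real.sin_sq_add_cos_sq (2 * Real.pi * L.latticeForm n (-m) u)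
      rw [hcos, hc1] at this
      exact pow_eq_zero_iff two_ne_zero |>.mp (by linarith)
    obtain ⟨i, hi⟩ := Real.sin_eq_zero_iff.mp hsin
    obtain ⟨j, hj⟩ := Real.sin_eq_zero_iff.mp hsin'
    have hi' : (i : ℝ) = 2 * L.latticeForm p r u :=
      mul_right_cancel₀ Real.pi_ne_zero (by linarith)
    have hj' : (j : ℝ) = 2 * L.latticeForm n (-m) u :=
      mul_right_cancel₀ Real.pi_ne_zero (by linarith)
    -- If both sines vanish, both lattice coordinates of `u` are half-integers, so `u` is a half
    -- period and `normP` is critical there.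
    have hmem : 2 * u ∈ L.lattice := by
      refine mem_lattice.mpr ⟨i * m + j * r, i * n - j * p, ?_⟩
      have hiC : (i : ℂ) = 2 * L.latticeForm p r u := by exact_mod_cast hi'
      have hjC : (j : ℂ) = 2 * L.latticeForm n (-m) u := by exact_mod_cast hj'
      push_cast
      rw [hiC, hjC]
      linear_combination -2 * L.eq_latticeForm_mul_add h u
    apply hne
    rw [(L.hasDerivAt_normP hu).deriv, L.derivWeierstrassP_eq_zero_of_two_mul_mem hmem, zero_div]
  choose y hy0 hy using key
  obtain ⟨t, -, ht⟩ := exists_hasDerivAt_eq_zero hT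
    (f := fun s => L.levelFun p r (γ s)) (f' := y)
    (fun s _ => (hy s).continuousAt.continuousWithinAt)
    (by simpa using congrArg (fun z : ℂ => L.levelFun p r z) (hper 0).symm) (fun s _ => hy s)
  exact hy0 t ht

/-- The closed trajectories are the non-critical level sets of `levelFun`. -/
theorem isClosedTrajectory_iff {ρ : ℝ} {D : ℂ} (hD : D ≠ 0)
    (hDρ : D = ρ * (m * L.ω₁ + n * L.ω₂)) {k : ℝ} (hk : 0 < k) {Γ : Set ℂ} :
    IsClosedTrajectory (puncturedSphere L.lambda) (L.lineDifferential D k) Γ ↔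
      ∃ c : ℝ, -1 < c ∧ c < 1 ∧ Γ = {z : ℂ | L.levelFun n (-m) z = c} := by
  constructor
  · rintro ⟨⟨-, hmax⟩, γ, T, hT, hper, hγ, rfl⟩
    obtain ⟨c, hc⟩ := L.exists_image_subset_levelSet hD hDρ hk hγ
    rw [image_univ] at hc
    have hc' : ∀ t, L.levelFun n (-m) (γ t) = c := fun t => hc (mem_range_self t)
    have hne := L.sq_ne_one_of_periodic_geodesic h hD hDρ hk hT hper hγ hc'
    have habs : |c| ≤ 1 := hc' 0 ▸ L.abs_levelFun_le_one n (-m) (γ 0)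
    obtain ⟨h1, h2⟩ := abs_le.mp habs
    have h1' : -1 < c := lt_of_le_of_ne h1 fun h => hne (by rw [← h]; norm_num)
    have h2' : c < 1 := lt_of_le_of_ne h2 fun h => hne (by rw [h]; norm_num)
    obtain ⟨δ, -, hδ, hr⟩ :=
      L.exists_periodic_geodesic_range_eq_levelSet h hD hDρ hk h1' h2'
    refine ⟨c, h1', h2', ?_⟩
    -- The full level is itself a geodesic containing `Γ`, so maximality forces equality.
    have := hmax univ δ hδ (by rwa [image_univ, hr])
    rw [← this, image_univ, hr]
  · rintro ⟨c, h1, h2, rfl⟩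
    obtain ⟨γ, hper, hγ, hr⟩ := L.exists_periodic_geodesic_range_eq_levelSet h hD hDρ hk h1 h2
    refine ⟨⟨⟨univ, γ, hγ, by rw [image_univ, hr]⟩, fun J δ hδ hsub => ?_⟩,
      γ, 1, one_pos, hper, hγ, hr.symm⟩
    obtain ⟨c', hc'⟩ := L.exists_image_subset_levelSet hD hDρ hk hδ
    have h0 : γ 0 ∈ {z : ℂ | L.levelFun n (-m) z = c} := hr ▸ mem_range_self 0
    obtain rfl : c = c' := h0.symm.trans (hc' (hsub h0))
    exact hc'.antisymm hsub

end Trajectories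

end PeriodPair

/-! ### Separated pairs and the parity of `m`, `n` -/

/-- A connected side containing `a` in one decomposition lies in the side of `a` in the other, so it
cannot contain `c`. -/
theorem SeparatesPairs.not_swap {Γ : Set ℂ} {a b c d c' : OnePoint ℂ}
    (h : SeparatesPairs Γ a b c d) : ¬ SeparatesPairs Γ a c b c' := by
  rintro ⟨V', W', -, -, hV', -, -, hU', ha', hc', -, -⟩
  obtain ⟨V, W, hV, hW, -, -, hd, hU, ha, -, hc, -⟩ := h
  have hsub : V' ⊆ V := hV'.isPreconnected.subset_left_of_subset_union hV hW hd
    (by rw [hU, ← hU']; exact subset_union_left) ⟨a, ha', ha⟩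
  exact disjoint_left.mp hd (hsub hc') hc

theorem SeparatesPairs.symm_right {Γ : Set ℂ} {a b c d : OnePoint ℂ}
    (h : SeparatesPairs Γ a b c d) : SeparatesPairs Γ a b d c := by
  obtain ⟨V, W, hV, hW, hV', hW', hd, hU, ha, hb, hc, hd'⟩ := h
  exact ⟨V, W, hV, hW, hV', hW', hd, hU, ha, hb, hd', hc⟩

theorem exists_isLowestTerms (q : OnePoint ℚ) : ∃ m n : ℤ, IsLowestTerms q m n := by
  induction q using OnePoint.rec with
  | infty => exact ⟨1, 0, isCoprime_one_left, fun _ => rfl, fun h => absurd rfl h⟩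
  | coe q =>
    refine ⟨q.num, q.den, Int.isCoprime_iff_nat_coprime.mpr (by simpa using q.reduced),
      fun h => absurd h (by exact_mod_cast q.den_nz), fun _ => ?_⟩
    rw [Int.cast_natCast, Rat.num_div_den]

theorem qDirection_ne_zero {τ : ℂ} (hτ : τ.im ≠ 0) (q : OnePoint ℚ) : qDirection τ q ≠ 0 := by
  induction q using OnePoint.rec with
  | infty =>
    rintro (rfl : τ = 0)
    exact hτ rfl
  | coe q =>
    intro (h : 1 + (q : ℂ) * τ = 0)
    have him := congrArg Complex.im h
    have hre := congrArg Complex.re h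
    have e : (q : ℂ) = ((q : ℝ) : ℂ) := by push_cast; rfl
    rw [e] at him hre
    simp [hτ] at him hre
    simp [him] at hre

theorem exists_qDirection_eq {τ : ℂ} {q : OnePoint ℚ} {m n : ℤ} (h : IsLowestTerms q m n) :
    ∃ ρ : ℝ, qDirection τ q = ρ * (m * τ + n * 1) := by
  obtain ⟨hcop, hinf, hrat⟩ := h
  by_cases hn : n = 0
  · subst hn
    rw [hinf rfl]
    have hm : (m : ℂ) * m = 1 := by
      rcases Int.isUnit_iff.mp (isCoprime_zero_right.mp hcop) with rfl | rfl <;> norm_num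
    -- Coprimality with `0` makes `m = ±1`, its own inverse.
    refine ⟨m, ?_⟩
    change τ = _
    push_cast
    linear_combination -τ * hm
  · rw [hrat hn]
    refine ⟨(n : ℝ)⁻¹, ?_⟩
    change 1 + (((m : ℚ) / (n : ℚ) : ℚ) : ℂ) * τ = _
    have hn' : (n : ℂ) ≠ 0 := by exact_mod_cast hn
    push_cast
    field_simp
    ring

theorem isClosedTrajectory_qDifferential_iff {μ τ : ℂ} {hτ : τ.im ≠ 0}
    (hlam : modularLambda τ hτ = μ) {q : OnePoint ℚ} {m n : ℤ} (hq : IsLowestTerms q m n)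
    {k : ℝ} (hk : 0 < k) {Γ : Set ℂ} :
    IsClosedTrajectory (puncturedSphere μ) (qDifferential μ τ hτ q k) Γ ↔
      ∃ c : ℝ, -1 < c ∧ c < 1 ∧
        Γ = {z : ℂ | (latticePair τ hτ).levelFun n (-m) z = c} := by
  obtain ⟨p, r, h⟩ := hq.1
  obtain ⟨ρ, hρ⟩ := exists_qDirection_eq (τ := τ) hq
  subst hlam
  exact (latticePair τ hτ).isClosedTrajectory_iff h (qDirection_ne_zero hτ q) hρ hk

theorem exists_isClosedTrajectory_qDifferential {μ τ : ℂ} {hτ : τ.im ≠ 0}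
    (hlam : modularLambda τ hτ = μ) (q : OnePoint ℚ) {k : ℝ} (hk : 0 < k) :
    ∃ Γ : Set ℂ, IsClosedTrajectory (puncturedSphere μ) (qDifferential μ τ hτ q k) Γ := by
  obtain ⟨m, n, hq⟩ := exists_isLowestTerms q
  exact ⟨_, (isClosedTrajectory_qDifferential_iff hlam hq hk).mpr
    ⟨0, by norm_num, by norm_num, rfl⟩⟩

theorem separatesPairs_of_isClosedTrajectory {μ τ : ℂ} {hτ : τ.im ≠ 0}
    (hlam : modularLambda τ hτ = μ) {q : OnePoint ℚ} {m n : ℤ} (hq : IsLowestTerms q m n)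
    {k : ℝ} (hk : 0 < k) {Γ : Set ℂ}
    (hΓ : IsClosedTrajectory (puncturedSphere μ) (qDifferential μ τ hτ q k) Γ) :
    (Odd m ∧ Even n ∧ SeparatesPairs Γ ∞ ((1 : ℂ) : OnePoint ℂ) ((0 : ℂ) : OnePoint ℂ)
        (μ : OnePoint ℂ)) ∨
      (Even m ∧ Odd n ∧ SeparatesPairs Γ ∞ ((0 : ℂ) : OnePoint ℂ) ((1 : ℂ) : OnePoint ℂ)
        (μ : OnePoint ℂ)) ∨
      (Odd m ∧ Odd n ∧ SeparatesPairs Γ ∞ (μ : OnePoint ℂ) ((0 : ℂ) : OnePoint ℂ)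
        ((1 : ℂ) : OnePoint ℂ)) := by
  obtain ⟨c, h1, h2, rfl⟩ := (isClosedTrajectory_qDifferential_iff hlam hq hk).mp hΓ
  obtain ⟨p, r, h⟩ := hq.1
  obtain rfl : (latticePair τ hτ).lambda = μ := hlam
  set L := latticePair τ hτ
  have v0 := L.levelFun_infty n (-m)
  have v1 := L.levelFun_one n (-m)
  have v2 := L.levelFun_zero n (-m)
  have v3 := L.levelFun_lambda n (-m)
  rcases Int.even_or_odd m with hm | hm <;> rcases Int.even_or_odd n with hn | hn
  · exfalso
    have : Even (p * m + r * n) := (hm.mul_left p).add (hn.mul_left r)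
    rw [h] at this
    exact absurd this (by decide)
  · rw [hn.neg_one_zpow] at v1
    rw [hm.neg.neg_one_zpow] at v2
    rw [(hn.add_even hm.neg).neg_one_zpow] at v3
    exact Or.inr (Or.inl ⟨hm, hn, L.separatesPairs_levelSet h h1 h2 (v0 ▸ h2) (v2 ▸ h2)
      (v1 ▸ h1) (v3 ▸ h1)⟩)
  · rw [hn.neg_one_zpow] at v1
    rw [hm.neg.neg_one_zpow] at v2
    rw [(hn.add_odd hm.neg).neg_one_zpow] at v3
    exact Or.inl ⟨hm, hn, L.separatesPairs_levelSet h h1 h2 (v0 ▸ h2) (v1 ▸ h2)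
      (v2 ▸ h1) (v3 ▸ h1)⟩
  · rw [hn.neg_one_zpow] at v1
    rw [hm.neg.neg_one_zpow] at v2
    rw [(hn.add_odd hm.neg).neg_one_zpow] at v3
    exact Or.inr (Or.inr ⟨hm, hn, L.separatesPairs_levelSet h h1 h2 (v0 ▸ h2) (v3 ▸ h2)
      (v2 ▸ h1) (v1 ▸ h1)⟩)

section Parts

variable {μ τ : ℂ} {hτ : τ.im ≠ 0} (hlam : modularLambda τ hτ = μ)
include hlam

theorem mem_separationPart_one_iff {q : OnePoint ℚ} {m n : ℤ} (hq : IsLowestTerms q m n) :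
    q ∈ separationPart μ τ hτ 1 0 μ ↔ Odd m ∧ Even n := by
  constructor
  · intro h
    -- Existence of a closed trajectory keeps membership from being vacuous; `Γ` then cannot
    -- separate the points in two ways.
    obtain ⟨Γ, hΓ⟩ := exists_isClosedTrajectory_qDifferential hlam q one_pos
    have hs := h 1 one_pos Γ hΓ
    rcases separatesPairs_of_isClosedTrajectory hlam hq one_pos hΓ with h | h | h
    · exact ⟨h.1, h.2.1⟩
    · exact absurd h.2.2 hs.not_swap
    · exact absurd h.2.2.symm_right hs.symm_right.not_swap
  · rintro ⟨hm, hn⟩ k hk Γ hΓ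
    rcases separatesPairs_of_isClosedTrajectory hlam hq hk hΓ with h | h | h
    · exact h.2.2
    · exact absurd hm (Int.not_odd_iff_even.mpr h.1)
    · exact absurd hn (Int.not_even_iff_odd.mpr h.2.1)

theorem mem_separationPart_zero_iff {q : OnePoint ℚ} {m n : ℤ} (hq : IsLowestTerms q m n) :
    q ∈ separationPart μ τ hτ 0 1 μ ↔ Even m ∧ Odd n := by
  constructor
  · intro h
    obtain ⟨Γ, hΓ⟩ := exists_isClosedTrajectory_qDifferential hlam q one_pos
    have hs := h 1 one_pos Γ hΓ
    rcases separatesPairs_of_isClosedTrajectory hlam hq one_pos hΓ with h | h | h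
    · exact absurd h.2.2 hs.not_swap
    · exact ⟨h.1, h.2.1⟩
    · exact absurd h.2.2 hs.symm_right.not_swap
  · rintro ⟨hm, hn⟩ k hk Γ hΓ
    rcases separatesPairs_of_isClosedTrajectory hlam hq hk hΓ with h | h | h
    · exact absurd hm (Int.not_even_iff_odd.mpr h.1)
    · exact h.2.2
    · exact absurd hm (Int.not_even_iff_odd.mpr h.1)

theorem mem_separationPart_mu_iff {q : OnePoint ℚ} {m n : ℤ} (hq : IsLowestTerms q m n) :
    q ∈ separationPart μ τ hτ μ 0 1 ↔ Odd m ∧ Odd n := by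
  constructor
  · intro h
    obtain ⟨Γ, hΓ⟩ := exists_isClosedTrajectory_qDifferential hlam q one_pos
    have hs := h 1 one_pos Γ hΓ
    rcases separatesPairs_of_isClosedTrajectory hlam hq one_pos hΓ with h | h | h
    · exact absurd h.2.2.symm_right hs.symm_right.not_swap
    · exact absurd h.2.2.symm_right hs.not_swap
    · exact ⟨h.1, h.2.1⟩
  · rintro ⟨hm, hn⟩ k hk Γ hΓ
    rcases separatesPairs_of_isClosedTrajectory hlam hq hk hΓ with h | h | h
    · exact absurd hn (Int.not_odd_iff_even.mpr h.2.1)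
    · exact absurd hm (Int.not_odd_iff_even.mpr h.1)
    · exact h.2.2

end Parts

theorem setOf_eq_of_forall_isLowestTerms {S : Set (OnePoint ℚ)} {P : ℤ → ℤ → Prop}
    (h : ∀ {q : OnePoint ℚ} {m n : ℤ}, IsLowestTerms q m n → (q ∈ S ↔ P m n)) :
    S = {q | ∃ m n : ℤ, IsLowestTerms q m n ∧ P m n} := by
  ext q
  constructor
  · intro hq
    obtain ⟨m, n, hmn⟩ := exists_isLowestTerms q
    exact ⟨m, n, hmn, (h hmn).mp hq⟩
  · rintro ⟨m, n, hmn, hP⟩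
    exact (h hmn).mpr hP

theorem isLowestTerms_int_one (m : ℤ) : IsLowestTerms ((m : ℚ) : OnePoint ℚ) m 1 :=
  ⟨isCoprime_one_right, fun h => absurd h one_ne_zero, fun _ => by simp⟩

end

theorem mainTheorem3 (μ τ : ℂ) (hμ0 : μ ≠ 0) (hμ1 : μ ≠ 1) (hτ : τ.im ≠ 0)
    (hlam : modularLambda τ hτ = μ) :
    -- the pair lying on the same side of a closed trajectory is given by the parities of `m, n`
    (∀ (q : OnePoint ℚ) (m n : ℤ), IsLowestTerms q m n → ∀ k : ℝ, 0 < k →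
      (∃ Γ : Set ℂ, IsClosedTrajectory (puncturedSphere μ) (qDifferential μ τ hτ q k) Γ) ∧
      ∀ Γ : Set ℂ, IsClosedTrajectory (puncturedSphere μ) (qDifferential μ τ hτ q k) Γ →
        (Odd m ∧ Even n ∧ SeparatesPairs Γ ∞ ((1 : ℂ) : OnePoint ℂ) ((0 : ℂ) : OnePoint ℂ) (μ : OnePoint ℂ)) ∨
        (Even m ∧ Odd n ∧ SeparatesPairs Γ ∞ ((0 : ℂ) : OnePoint ℂ) ((1 : ℂ) : OnePoint ℂ) (μ : OnePoint ℂ)) ∨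
        (Odd m ∧ Odd n ∧ SeparatesPairs Γ ∞ (μ : OnePoint ℂ) ((0 : ℂ) : OnePoint ℂ) ((1 : ℂ) : OnePoint ℂ))) ∧
    -- the three parts of `ℚ ∪ {∞}` are the three parity classes
    separationPart μ τ hτ 1 0 μ = {q | ∃ m n : ℤ, IsLowestTerms q m n ∧ Odd m ∧ Even n} ∧
    separationPart μ τ hτ 0 1 μ = {q | ∃ m n : ℤ, IsLowestTerms q m n ∧ Even m ∧ Odd n} ∧
    separationPart μ τ hτ μ 0 1 = {q | ∃ m n : ℤ, IsLowestTerms q m n ∧ Odd m ∧ Odd n} ∧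
    -- they form a partition
    (separationPart μ τ hτ 1 0 μ).Nonempty ∧
    (separationPart μ τ hτ 0 1 μ).Nonempty ∧
    (separationPart μ τ hτ μ 0 1).Nonempty ∧
    Disjoint (separationPart μ τ hτ 1 0 μ) (separationPart μ τ hτ 0 1 μ) ∧
    Disjoint (separationPart μ τ hτ 1 0 μ) (separationPart μ τ hτ μ 0 1) ∧
    Disjoint (separationPart μ τ hτ 0 1 μ) (separationPart μ τ hτ μ 0 1) ∧
    separationPart μ τ hτ 1 0 μ ∪ separationPart μ τ hτ 0 1 μ ∪ separationPart μ τ hτ μ 0 1 =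
      Set.univ := by
  have m1 := fun {q : OnePoint ℚ} {m n : ℤ} (hq : IsLowestTerms q m n) =>
    mem_separationPart_one_iff hlam hq
  have m2 := fun {q : OnePoint ℚ} {m n : ℤ} (hq : IsLowestTerms q m n) =>
    mem_separationPart_zero_iff hlam hq
  have m3 := fun {q : OnePoint ℚ} {m n : ℤ} (hq : IsLowestTerms q m n) =>
    mem_separationPart_mu_iff hlam hq
  refine ⟨fun q m n hq k hk => ⟨exists_isClosedTrajectory_qDifferential hlam q hk,
      fun Γ hΓ => separatesPairs_of_isClosedTrajectory hlam hq hk hΓ⟩,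
    setOf_eq_of_forall_isLowestTerms m1, setOf_eq_of_forall_isLowestTerms m2,
    setOf_eq_of_forall_isLowestTerms m3,
    ⟨∞, (m1 (m := 1) (n := 0) ⟨isCoprime_one_left, fun _ => rfl, fun h => absurd rfl h⟩).mpr
      ⟨odd_one, Even.zero⟩⟩,
    ⟨_, (m2 (isLowestTerms_int_one 0)).mpr ⟨Even.zero, odd_one⟩⟩,
    ⟨_, (m3 (isLowestTerms_int_one 1)).mpr ⟨odd_one, odd_one⟩⟩, ?_, ?_, ?_, ?_⟩
  · refine Set.disjoint_left.mpr fun q h h' => ?_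
    obtain ⟨m, n, hq⟩ := exists_isLowestTerms q
    exact Int.not_even_iff_odd.mpr ((m1 hq).mp h).1 ((m2 hq).mp h').1
  · refine Set.disjoint_left.mpr fun q h h' => ?_
    obtain ⟨m, n, hq⟩ := exists_isLowestTerms q
    exact Int.not_even_iff_odd.mpr ((m3 hq).mp h').2 ((m1 hq).mp h).2
  · refine Set.disjoint_left.mpr fun q h h' => ?_
    obtain ⟨m, n, hq⟩ := exists_isLowestTerms q
    exact Int.not_even_iff_odd.mpr ((m3 hq).mp h').1 ((m2 hq).mp h).1
  · refine Set.eq_univ_of_forall fun q => ?_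
    obtain ⟨m, n, hq⟩ := exists_isLowestTerms q
    obtain ⟨Γ, hΓ⟩ := exists_isClosedTrajectory_qDifferential hlam q one_pos
    rcases separatesPairs_of_isClosedTrajectory hlam hq one_pos hΓ with h | h | h
    · exact Or.inl (Or.inl ((m1 hq).mpr ⟨h.1, h.2.1⟩))
    · exact Or.inl (Or.inr ((m2 hq).mpr ⟨h.1, h.2.1⟩))
    · exact Or.inr ((m3 hq).mpr ⟨h.1, h.2.1⟩)
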